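/- Let $X\subset\mathbb{C}$ be a connected perfect compact set. A function $f:X\to\mathbb{C}$ is differentiable at $x\in X$ if $f'(x)=\lim_{z\to x,\ z\in X\setminus\{x\}}\frac{f(z)-f(x)}{z-x}$ exists, and $D^\infty(X)$ is the set of infinitely differentiable functions on $X$. Let $(M_n)_{n\ge 0}$ be a sequence of positive numbers with $M_0=1$ and $\frac{M_{n+m}}{M_nM_m}\ge\binom{n+m}{m}$ for all $n,m\ge 0$, which is nonanalytic, i.e. $\lim_{n\to\infty}(n!/M_n)^{1/n}=0$. Let $$D(X,M)=\Big\{f\in D^\infty(X):\ \|f\|=\sum_{n=0}^\infty\frac{\|f^{(n)}\|_\infty}{M_n}<\infty\Big\}$$ with pointwise operations, where $\|\cdot\|_\infty$ is the supremum norm over $X$. Suppose that the normed algebra $D(X,M)$ is complete and that its maximal ideal space is $X$, i.e. $x\mapsto(f\mapsto f(x))$ is a homeomorphism of $X$ onto the maximal ideal space. A bounded linear operator $T$ on a complex Banach space is a Riesz operator if for every $\lambda\ne 0$ the operator $\lambda-T$ is open as a map onto its range and has closed range, its kernel and the quotient by its range have finite and equal dimension, and its null chain $(N((\lambda-T)^n))_n$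 and image chain $(R((\lambda-T)^n))_n$ have finite and equal length; and if moreover the nonzero spectrum of $T$ consists of eigenvalues which, if there are infinitely many of them, form a sequence tending to $0$. **Lemma 2.2.** Let $T$ be an endomorphism of the algebra $D(X,M)$ which is a Riesz operator and is induced by a selfmap $\phi:X\to X$, that is, $Tf(x)=f(\phi(x))$ for all $f\in D(X,M)$ and $x\in X$. If $x_0\in X$ is a fixed point of $\phi$, then $\phi$ is differentiable at $x_0$ (relative to $X$) and $|\phi'(x_0)|<1$. -/

import Mathlib

open Filter Topology
open scoped ContDiff

noncomputable section

/-- A perfect compact subset of the complex plane (perfect: closed, with no isolated points). -/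
structure PerfectCompact where
  /-- The underlying set of complex numbers. -/
  carrier : Set ℂ
  isCompact : IsCompact carrier
  perfect : Perfect carrier

/-- An algebra weight sequence: positive numbers with `M 0 = 1` and
`M (n + m) / (M n * M m) ≥ (n + m).choose m`. -/
structure WeightSequence where
  /-- The underlying sequence. -/
  toFun : ℕ → ℝ
  pos : ∀ n, 0 < toFun n
  map_zero : toFun 0 = 1
  choose_le : ∀ n m, ((n + m).choose m : ℝ) ≤ toFun (n + m) / (toFun n * toFun m)

/-- The weight sequence is nonanalytic: `(n! / M n) ^ (1 / n) → 0`. -/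
def WeightSequence.IsNonanalytic (M : WeightSequence) : Prop :=
  Tendsto (fun n : ℕ => ((n.factorial : ℝ) / M.toFun n) ^ (1 / (n : ℝ))) atTop (𝓝 0)

namespace PerfectCompact

variable (X : PerfectCompact)

/-- Extension by zero of a function on `X` to the plane. The derivatives below are taken within
`X`, at points of `X`, so they depend only on the values of the function on `X`. -/
def zeroExt (f : X.carrier → ℂ) : ℂ → ℂ := Function.extend Subtype.val f 0

/-- `f` is complex differentiable at `x` relative to `X`: the quotient `(f z - f x) / (z - x)`
has a limit as `z → x` with `z ∈ X`, `z ≠ x`. -/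
def DifferentiableAt (f : X.carrier → ℂ) (x : X.carrier) : Prop :=
  DifferentiableWithinAt ℂ (X.zeroExt f) X.carrier x

/-- The `n`-th complex derivative of `f` relative to `X`. -/
def iterDeriv (n : ℕ) (f : X.carrier → ℂ) (x : X.carrier) : ℂ :=
  iteratedDerivWithin n (X.zeroExt f) X.carrier x

/-- The complex derivative of `f` relative to `X`. -/
def deriv (f : X.carrier → ℂ) (x : X.carrier) : ℂ :=
  derivWithin (X.zeroExt f) X.carrier x

/-- `f` is infinitely differentiable on `X`: each iterated derivative relative to `X`
is differentiable at every point of `X`, relative to `X`. -/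
def IsSmooth (f : X.carrier → ℂ) : Prop :=
  ∀ (n : ℕ) (x : X.carrier), X.DifferentiableAt (X.iterDeriv n f) x

/-- The supremum norm over `X`. -/
def supNorm (f : X.carrier → ℂ) : ℝ := ⨆ x : X.carrier, ‖f x‖

variable {X}

theorem zeroExt_apply (f : X.carrier → ℂ) (x : X.carrier) : X.zeroExt f x = f x :=
  Subtype.val_injective.extend_apply f 0 x

theorem zeroExt_of_mem (f : X.carrier → ℂ) {z : ℂ} (hz : z ∈ X.carrier) :
    X.zeroExt f z = f ⟨z, hz⟩ :=
  zeroExt_apply f ⟨z, hz⟩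

theorem uniqueDiffOn : UniqueDiffOn ℂ X.carrier := fun x hx =>
  uniqueDiffWithinAt_iff_accPt.2 (X.perfect.acc x hx)

theorem eqOn_zeroExt_iterDeriv (n : ℕ) (f : X.carrier → ℂ) :
    Set.EqOn (X.zeroExt (X.iterDeriv n f)) (iteratedDerivWithin n (X.zeroExt f) X.carrier)
      X.carrier :=
  fun _ hz => zeroExt_of_mem _ hz

theorem iterDeriv_zero (f : X.carrier → ℂ) : X.iterDeriv 0 f = f := by
  funext x; simp [iterDeriv, zeroExt_apply]

theorem iterDeriv_succ (n : ℕ) (f : X.carrier → ℂ) :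
    X.iterDeriv (n + 1) f = X.deriv (X.iterDeriv n f) := by
  funext x
  rw [iterDeriv, deriv, iteratedDerivWithin_succ]
  exact (derivWithin_congr (eqOn_zeroExt_iterDeriv n f) (eqOn_zeroExt_iterDeriv n f x.2)).symm

theorem isSmooth_iff_contDiffOn {f : X.carrier → ℂ} :
    X.IsSmooth f ↔ ContDiffOn ℂ ∞ (X.zeroExt f) X.carrier := by
  constructor
  · intro h
    refine contDiffOn_of_differentiableOn_deriv fun m _ x hx => ?_
    exact (h m ⟨x, hx⟩).congr (fun y hy => (eqOn_zeroExt_iterDeriv m f hy).symm)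
      (eqOn_zeroExt_iterDeriv m f hx).symm
  · intro h n x
    have := h.differentiableOn_iteratedDerivWithin (m := n)
      (by exact_mod_cast WithTop.coe_lt_coe.2 (ENat.natCast_lt_top n)) uniqueDiffOn x x.2
    exact this.congr (eqOn_zeroExt_iterDeriv n f) (eqOn_zeroExt_iterDeriv n f x.2)

theorem IsSmooth.contDiffWithinAt {f : X.carrier → ℂ} (hf : X.IsSmooth f) (n : ℕ)
    (x : X.carrier) : ContDiffWithinAt ℂ n (X.zeroExt f) X.carrier x :=
  ((isSmooth_iff_contDiffOn.1 hf).of_le (by exact_mod_cast le_top)) x x.2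

theorem zeroExt_add (f g : X.carrier → ℂ) : X.zeroExt (f + g) = X.zeroExt f + X.zeroExt g := by
  funext z
  by_cases hz : z ∈ X.carrier
  · simp [zeroExt_of_mem _ hz]
  · have : ¬ ∃ a : X.carrier, (a : ℂ) = z := by rintro ⟨a, rfl⟩; exact hz a.2
    simp [zeroExt, Function.extend_apply' _ _ _ this]

theorem zeroExt_mul (f g : X.carrier → ℂ) : X.zeroExt (f * g) = X.zeroExt f * X.zeroExt g := by
  funext z
  by_cases hz : z ∈ X.carrier
  · simp [zeroExt_of_mem _ hz]
  · have : ¬ ∃ a : X.carrier, (a : ℂ) = z := by rintro ⟨a, rfl⟩; exact hz a.2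
    simp [zeroExt, Function.extend_apply' _ _ _ this]

theorem zeroExt_smul (c : ℂ) (f : X.carrier → ℂ) : X.zeroExt (c • f) = c • X.zeroExt f := by
  funext z
  by_cases hz : z ∈ X.carrier
  · simp [zeroExt_of_mem _ hz]
  · have : ¬ ∃ a : X.carrier, (a : ℂ) = z := by rintro ⟨a, rfl⟩; exact hz a.2
    simp [zeroExt, Function.extend_apply' _ _ _ this]

theorem eqOn_zeroExt_const (c : ℂ) :
    Set.EqOn (X.zeroExt fun _ => c) (fun _ => c) X.carrier :=
  fun _ hz => zeroExt_of_mem _ hz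

theorem isSmooth_const (c : ℂ) : X.IsSmooth fun _ => c :=
  isSmooth_iff_contDiffOn.2 (contDiffOn_const.congr (eqOn_zeroExt_const c))

theorem IsSmooth.add {f g : X.carrier → ℂ} (hf : X.IsSmooth f) (hg : X.IsSmooth g) :
    X.IsSmooth (f + g) := by
  rw [isSmooth_iff_contDiffOn, zeroExt_add] at *
  exact hf.add hg

theorem IsSmooth.mul {f g : X.carrier → ℂ} (hf : X.IsSmooth f) (hg : X.IsSmooth g) :
    X.IsSmooth (f * g) := by
  rw [isSmooth_iff_contDiffOn, zeroExt_mul] at *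
  exact hf.mul hg

theorem iterDeriv_const (c : ℂ) (n : ℕ) (hn : n ≠ 0) :
    X.iterDeriv n (fun _ => c) = 0 := by
  funext x
  rw [iterDeriv, iteratedDerivWithin_congr (eqOn_zeroExt_const c) x.2]
  simp [iteratedDerivWithin_const, hn]

theorem iterDeriv_add {f g : X.carrier → ℂ} (hf : X.IsSmooth f) (hg : X.IsSmooth g) (n : ℕ) :
    X.iterDeriv n (f + g) = X.iterDeriv n f + X.iterDeriv n g := by
  funext x
  rw [iterDeriv, zeroExt_add]
  exact iteratedDerivWithin_add x.2 uniqueDiffOn (hf.contDiffWithinAt n x)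
    (hg.contDiffWithinAt n x)

theorem iterDeriv_smul (c : ℂ) (f : X.carrier → ℂ) (n : ℕ) :
    X.iterDeriv n (c • f) = c • X.iterDeriv n f := by
  funext x
  rw [iterDeriv, zeroExt_smul]
  exact iteratedDerivWithin_const_smul_field c _

theorem iterDeriv_mul {f g : X.carrier → ℂ} (hf : X.IsSmooth f) (hg : X.IsSmooth g) (n : ℕ)
    (x : X.carrier) :
    X.iterDeriv n (f * g) x =
      ∑ i ∈ Finset.range (n + 1), n.choose i * X.iterDeriv i f x * X.iterDeriv (n - i) g x := by
  rw [iterDeriv, zeroExt_mul]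
  exact iteratedDerivWithin_mul x.2 uniqueDiffOn (hf.contDiffWithinAt n x)
    (hg.contDiffWithinAt n x)

theorem supNorm_nonneg (f : X.carrier → ℂ) : 0 ≤ X.supNorm f :=
  Real.iSup_nonneg fun _ => norm_nonneg _

theorem IsSmooth.bddAbove {f : X.carrier → ℂ} (hf : X.IsSmooth f) (n : ℕ) :
    BddAbove (Set.range fun x : X.carrier => ‖X.iterDeriv n f x‖) := by
  have hc : ContinuousOn (iteratedDerivWithin n (X.zeroExt f) X.carrier) X.carrier :=
    (isSmooth_iff_contDiffOn.1 hf).continuousOn_iteratedDerivWithin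
      (by exact_mod_cast le_top) uniqueDiffOn
  obtain ⟨C, hC⟩ := X.isCompact.exists_bound_of_continuousOn hc
  exact ⟨C, by rintro _ ⟨x, rfl⟩; exact hC x x.2⟩

theorem IsSmooth.norm_le_supNorm {f : X.carrier → ℂ} (hf : X.IsSmooth f) (n : ℕ)
    (x : X.carrier) : ‖X.iterDeriv n f x‖ ≤ X.supNorm (X.iterDeriv n f) :=
  le_ciSup (hf.bddAbove n) x

theorem supNorm_le {f : X.carrier → ℂ} {C : ℝ} (hC : 0 ≤ C) (h : ∀ x, ‖f x‖ ≤ C) :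
    X.supNorm f ≤ C :=
  Real.iSup_le h hC

theorem supNorm_iterDeriv_add_le {f g : X.carrier → ℂ} (hf : X.IsSmooth f) (hg : X.IsSmooth g)
    (n : ℕ) : X.supNorm (X.iterDeriv n (f + g)) ≤
      X.supNorm (X.iterDeriv n f) + X.supNorm (X.iterDeriv n g) := by
  refine supNorm_le (add_nonneg (supNorm_nonneg _) (supNorm_nonneg _)) fun x => ?_
  rw [iterDeriv_add hf hg]
  exact (norm_add_le _ _).trans (add_le_add (hf.norm_le_supNorm n x) (hg.norm_le_supNorm n x))

theorem supNorm_iterDeriv_smul (c : ℂ) (f : X.carrier → ℂ) (n : ℕ) :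
    X.supNorm (X.iterDeriv n (c • f)) = ‖c‖ * X.supNorm (X.iterDeriv n f) := by
  simp only [supNorm, iterDeriv_smul, Pi.smul_apply, norm_smul]
  exact (Real.mul_iSup_of_nonneg (norm_nonneg c) _).symm

theorem supNorm_iterDeriv_mul_le {f g : X.carrier → ℂ} (hf : X.IsSmooth f) (hg : X.IsSmooth g)
    (n : ℕ) : X.supNorm (X.iterDeriv n (f * g)) ≤
      ∑ i ∈ Finset.range (n + 1), n.choose i * X.supNorm (X.iterDeriv i f) *
        X.supNorm (X.iterDeriv (n - i) g) := by
  refine supNorm_le (Finset.sum_nonneg fun i _ => mul_nonneg (mul_nonneg (Nat.cast_nonneg _)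
    (supNorm_nonneg _)) (supNorm_nonneg _)) fun x => ?_
  rw [iterDeriv_mul hf hg]
  refine (norm_sum_le _ _).trans (Finset.sum_le_sum fun i _ => ?_)
  rw [norm_mul, norm_mul, Complex.norm_natCast]
  exact mul_le_mul (mul_le_mul_of_nonneg_left (hf.norm_le_supNorm i x) (Nat.cast_nonneg _))
    (hg.norm_le_supNorm _ x) (norm_nonneg _)
    (mul_nonneg (Nat.cast_nonneg _) (supNorm_nonneg _))

end PerfectCompact

section DalesDavie

open PerfectCompact

variable (X : PerfectCompact) (M : WeightSequence)

/-- The `n`-th term `‖f⁽ⁿ⁾‖_∞ / M n` of the series defining the norm of `D(X, M)`. -/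
def daviesTerm (f : X.carrier → ℂ) (n : ℕ) : ℝ := X.supNorm (X.iterDeriv n f) / M.toFun n

variable {X M}

theorem daviesTerm_nonneg (f : X.carrier → ℂ) (n : ℕ) : 0 ≤ daviesTerm X M f n :=
  div_nonneg (supNorm_nonneg _) (M.pos n).le

theorem daviesTerm_add_le {f g : X.carrier → ℂ} (hf : X.IsSmooth f) (hg : X.IsSmooth g) (n : ℕ) :
    daviesTerm X M (f + g) n ≤ daviesTerm X M f n + daviesTerm X M g n := by
  rw [daviesTerm, daviesTerm, daviesTerm, ← add_div]
  exact div_le_div_of_nonneg_right (supNorm_iterDeriv_add_le hf hg n) (M.pos n).le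

theorem daviesTerm_smul (c : ℂ) (f : X.carrier → ℂ) (n : ℕ) :
    daviesTerm X M (c • f) n = ‖c‖ * daviesTerm X M f n := by
  rw [daviesTerm, daviesTerm, supNorm_iterDeriv_smul, mul_div_assoc]

theorem daviesTerm_mul_le {f g : X.carrier → ℂ} (hf : X.IsSmooth f) (hg : X.IsSmooth g) (n : ℕ) :
    daviesTerm X M (f * g) n ≤
      ∑ i ∈ Finset.range (n + 1), daviesTerm X M f i * daviesTerm X M g (n - i) := by
  refine (div_le_div_of_nonneg_right (supNorm_iterDeriv_mul_le hf hg n) (M.pos n).le).trans ?_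
  rw [Finset.sum_div]
  refine Finset.sum_le_sum fun i hi => ?_
  have hin : i ≤ n := Nat.lt_succ_iff.1 (Finset.mem_range.1 hi)
  have h := M.choose_le i (n - i)
  rw [Nat.add_sub_cancel' hin, Nat.choose_symm hin] at h
  have hi0 := M.pos i
  have hj0 := M.pos (n - i)
  rw [le_div_iff₀ (mul_pos hi0 hj0)] at h
  rw [daviesTerm, daviesTerm, div_mul_div_comm, div_le_div_iff₀ (M.pos n) (mul_pos hi0 hj0)]
  have hs : 0 ≤ X.supNorm (X.iterDeriv i f) * X.supNorm (X.iterDeriv (n - i) g) :=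
    mul_nonneg (supNorm_nonneg _) (supNorm_nonneg _)
  calc _ = (X.supNorm (X.iterDeriv i f) * X.supNorm (X.iterDeriv (n - i) g)) *
        (n.choose i * (M.toFun i * M.toFun (n - i))) := by ring
    _ ≤ _ := mul_le_mul_of_nonneg_left h hs

theorem summable_daviesTerm_const (c : ℂ) : Summable (daviesTerm X M fun _ => c) := by
  refine summable_of_ne_finset_zero (s := {0}) fun n hn => ?_
  rw [daviesTerm, iterDeriv_const c n (by simpa using hn)]
  simp [supNorm]

theorem summable_cauchy {f g : X.carrier → ℂ} (hf : Summable (daviesTerm X M f))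
    (hg : Summable (daviesTerm X M g)) :
    Summable fun n => ∑ i ∈ Finset.range (n + 1), daviesTerm X M f i * daviesTerm X M g (n - i) :=
  summable_sum_mul_range_of_summable_norm' hf.norm hf hg.norm hg

variable (X M)

/-- `D(X, M)` as a subalgebra of the algebra of all functions `X → ℂ` with pointwise operations:
the infinitely differentiable `f` with `∑ ‖f⁽ⁿ⁾‖_∞ / M n < ∞`. -/
def dalesDavieSubalgebra : Subalgebra ℂ (X.carrier → ℂ) where
  carrier := {f | X.IsSmooth f ∧ Summable (daviesTerm X M f)}
  mul_mem' hf hg := ⟨hf.1.mul hg.1,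
    (summable_cauchy hf.2 hg.2).of_nonneg_of_le (fun n => daviesTerm_nonneg _ n)
      (fun n => daviesTerm_mul_le hf.1 hg.1 n)⟩
  add_mem' hf hg := ⟨hf.1.add hg.1,
    (hf.2.add hg.2).of_nonneg_of_le (fun n => daviesTerm_nonneg _ n)
      (fun n => daviesTerm_add_le hf.1 hg.1 n)⟩
  algebraMap_mem' c := ⟨isSmooth_const c, summable_daviesTerm_const c⟩

/-- The Dales-Davie algebra `D(X, M)`, as a type of its own: its topology is that of the norm
below, not the topology of pointwise convergence. -/
def DalesDavie : Type := dalesDavieSubalgebra X M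

namespace DalesDavie

instance : CommRing (DalesDavie X M) := inferInstanceAs (CommRing (dalesDavieSubalgebra X M))

instance : Algebra ℂ (DalesDavie X M) :=
  inferInstanceAs (Algebra ℂ (dalesDavieSubalgebra X M))

instance : CoeFun (DalesDavie X M) (fun _ => X.carrier → ℂ) := ⟨Subtype.val⟩

variable {X M}

@[ext]
theorem ext {f g : DalesDavie X M} (h : ∀ x, f x = g x) : f = g := Subtype.ext (funext h)

theorem isSmooth (f : DalesDavie X M) : X.IsSmooth f := f.2.1

theorem summable (f : DalesDavie X M) : Summable (daviesTerm X M f) := f.2.2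

@[simp] theorem add_apply (f g : DalesDavie X M) (x : X.carrier) : (f + g) x = f x + g x := rfl

@[simp] theorem mul_apply (f g : DalesDavie X M) (x : X.carrier) : (f * g) x = f x * g x := rfl

@[simp] theorem smul_apply (c : ℂ) (f : DalesDavie X M) (x : X.carrier) :
    (c • f) x = c * f x := rfl

@[simp] theorem one_apply (x : X.carrier) : (1 : DalesDavie X M) x = 1 := rfl

variable (X M) in
/-- The norm `‖f‖ = ∑ ‖f⁽ⁿ⁾‖_∞ / M n` of `D(X, M)`. -/
def ringNorm : RingNorm (DalesDavie X M) where
  toFun f := ∑' n, daviesTerm X M f n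
  map_zero' := by
    have h : ∀ n, daviesTerm X M ((0 : DalesDavie X M) : X.carrier → ℂ) n = 0 := fun n => by
      have := daviesTerm_smul (X := X) (M := M) 0 ((0 : DalesDavie X M) : X.carrier → ℂ) n
      rwa [zero_smul, norm_zero, zero_mul] at this
    simp only [h, tsum_zero]
  add_le' f g := by
    rw [← f.summable.tsum_add g.summable]
    exact (f + g).summable.tsum_le_tsum (fun n => daviesTerm_add_le f.isSmooth g.isSmooth n)
      (f.summable.add g.summable)
  neg' f := by
    have h : ∀ n, daviesTerm X M ((-f : DalesDavie X M) : X.carrier → ℂ) n =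
        daviesTerm X M f n := fun n => by
      have := daviesTerm_smul (X := X) (M := M) (-1) (f : X.carrier → ℂ) n
      rwa [neg_one_smul, norm_neg, norm_one, one_mul] at this
    simp only [h]
  mul_le' f g := by
    rw [tsum_mul_tsum_eq_tsum_sum_range_of_summable_norm f.summable.norm g.summable.norm]
    exact (f * g).summable.tsum_le_tsum (fun n => daviesTerm_mul_le f.isSmooth g.isSmooth n)
      (summable_cauchy f.summable g.summable)
  eq_zero_of_map_eq_zero' f hf := by
    ext x
    have h0 : daviesTerm X M f 0 ≤ ∑' n, daviesTerm X M f n :=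
      f.summable.le_tsum 0 fun n _ => daviesTerm_nonneg _ n
    have h1 := f.isSmooth.norm_le_supNorm 0 x
    rw [daviesTerm, M.map_zero, div_one] at h0
    rw [iterDeriv_zero] at h0 h1
    exact norm_le_zero_iff.1 ((h1.trans h0).trans hf.le)

instance : NormedCommRing (DalesDavie X M) :=
  { (ringNorm X M).toNormedRing, (inferInstance : CommRing (DalesDavie X M)) with }

theorem norm_def (f : DalesDavie X M) :
    ‖f‖ = ∑' n, X.supNorm (X.iterDeriv n f) / M.toFun n := rfl

instance : NormedAlgebra ℂ (DalesDavie X M) where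
  norm_smul_le c f := by
    change ∑' n, daviesTerm X M (c • (f : X.carrier → ℂ)) n ≤ ‖c‖ * ∑' n, daviesTerm X M f n
    simp only [daviesTerm_smul, tsum_mul_left, le_refl]

theorem norm_apply_le (f : DalesDavie X M) (x : X.carrier) : ‖f x‖ ≤ ‖f‖ := by
  have h0 : daviesTerm X M f 0 ≤ ∑' n, daviesTerm X M f n :=
    f.summable.le_tsum 0 fun n _ => daviesTerm_nonneg _ n
  have h1 := f.isSmooth.norm_le_supNorm 0 x
  rw [daviesTerm, M.map_zero, div_one] at h0
  rw [iterDeriv_zero] at h0 h1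
  exact h1.trans h0

variable (X M)

/-- Evaluation at a point `x` of `X`, as an element of the maximal ideal space (the space of
characters, with the weak-* topology) of `D(X, M)`. -/
def evalCharacter (x : X.carrier) : WeakDual.characterSpace ℂ (DalesDavie X M) :=
  ⟨StrongDual.toWeakDual (LinearMap.mkContinuous
      { toFun := fun f : DalesDavie X M => f x
        map_add' := fun _ _ => rfl
        map_smul' := fun _ _ => rfl } 1
      (fun f => (norm_apply_le f x).trans (one_mul ‖f‖).ge)),
    fun h => one_ne_zero (α := ℂ) (DFunLike.congr_fun h (1 : DalesDavie X M)),
    fun _ _ => rfl⟩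

theorem evalCharacter_apply (x : X.carrier) (f : DalesDavie X M) :
    evalCharacter X M x f = f x := rfl

/-- The maximal ideal space of `D(X, M)` is `X`: sending a point of `X` to the evaluation there is
a homeomorphism of `X` onto the maximal ideal space. -/
def MaximalIdealSpaceEq : Prop := IsHomeomorph (evalCharacter X M)

end DalesDavie

end DalesDavie

/-- A bounded operator `T` on a Banach space is a Riesz operator if for each nonzero `μ` the
operator `μ - T` is open (as a map onto its range) and has closed range, its kernel has finite
dimension equal to the codimension of its range, its null chain and its image chain have finite
and equal length, and the nonzero spectrum of `T` consists of eigenvalues which are finite in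
number or form a sequence tending to `0`. -/
structure IsRieszOperator {B : Type*} [NormedAddCommGroup B] [NormedSpace ℂ B]
    (T : B →L[ℂ] B) : Prop where
  isOpenMap : ∀ μ : ℂ, μ ≠ 0 →
    IsOpenMap (Set.rangeFactorization (algebraMap ℂ (B →L[ℂ] B) μ - T))
  isClosed_range : ∀ μ : ℂ, μ ≠ 0 →
    IsClosed (Set.range (algebraMap ℂ (B →L[ℂ] B) μ - T))
  finite_ker : ∀ μ : ℂ, μ ≠ 0 →
    FiniteDimensional ℂ (LinearMap.ker (algebraMap ℂ (B →L[ℂ] B) μ - T).toLinearMap)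
  finite_coker : ∀ μ : ℂ, μ ≠ 0 →
    FiniteDimensional ℂ (B ⧸ LinearMap.range (algebraMap ℂ (B →L[ℂ] B) μ - T).toLinearMap)
  finrank_ker_eq : ∀ μ : ℂ, μ ≠ 0 →
    Module.finrank ℂ (LinearMap.ker (algebraMap ℂ (B →L[ℂ] B) μ - T).toLinearMap) =
      Module.finrank ℂ (B ⧸ LinearMap.range (algebraMap ℂ (B →L[ℂ] B) μ - T).toLinearMap)
  chains : ∀ μ : ℂ, μ ≠ 0 → ∃ p : ℕ,
    IsLeast {n : ℕ | LinearMap.ker ((algebraMap ℂ (B →L[ℂ] B) μ - T) ^ n).toLinearMap =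
      LinearMap.ker ((algebraMap ℂ (B →L[ℂ] B) μ - T) ^ (n + 1)).toLinearMap} p ∧
    IsLeast {n : ℕ | LinearMap.range ((algebraMap ℂ (B →L[ℂ] B) μ - T) ^ n).toLinearMap =
      LinearMap.range ((algebraMap ℂ (B →L[ℂ] B) μ - T) ^ (n + 1)).toLinearMap} p
  hasEigenvalue : ∀ μ ∈ spectrum ℂ T, μ ≠ 0 → Module.End.HasEigenvalue T.toLinearMap μ
  spectrum_tendsto_zero : {μ ∈ spectrum ℂ T | μ ≠ 0}.Infinite →
    ∃ u : ℕ → ℂ, Set.range u = {μ ∈ spectrum ℂ T | μ ≠ 0} ∧ Tendsto u atTop (𝓝 0)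

end

/-! The map φ is smooth because it is the image under T of the coordinate function. Put c = φ'(x₀)
and let Iₙ be the space of functions whose derivatives of order less than n vanish at x₀. The Iₙ
decrease and have finite codimension, and (z - x₀)ⁿ lies in Iₙ but not in Iₙ₊₁. By the chain rule T
acts on Iₙ / Iₙ₊₁ as multiplication by cⁿ (`comp_sub_smul_mem_vanishing`).

Hence cⁿ - T preserves Iₙ₊₁ and kills the class of (z - x₀)ⁿ in the finite-dimensional quotient by
Iₙ₊₁. It is therefore not surjective, and every cⁿ lies in the spectrum
(`not_surjective_of_filtration`). If |c| ≥ 1, all these powers have modulus at least 1, where a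
Riesz operator has only finitely many spectral points, so c is a root of unity.

Then 1 = cⁿ for infinitely many n, and 1 - T kills infinitely many graded pieces. But the image
chain of 1 - T stabilises at a subspace R of finite codimension with (1 - T)R = R. Such an R
contributes nothing to those graded pieces, although its finite codimension lets it miss only
finitely many of them (`not_cofg_of_filtration`). -/

noncomputable section

/-! ### Linear algebra: filtrations of finite codimension. -/

section LinearAlgebra

variable {K V : Type*} [Field K] [AddCommGroup V] [Module K V]

/-- If G is a complement of N and F a complement of the range of A, then A(N) + A(G) + F is
everything, so A(G) + F spans the quotient by A(N). -/
theorem Submodule.CoFG.map_of_range {A : V →ₗ[K] V} (hA : (LinearMap.range A).CoFG)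
    {N : Submodule K V} (hN : N.CoFG) : (N.map A).CoFG := by
  obtain ⟨F, hF⟩ := (LinearMap.range A).exists_isCompl
  obtain ⟨G, hG⟩ := N.exists_isCompl
  have hsup : N.map A ⊔ (G.map A ⊔ F) = ⊤ := by
    rw [← sup_assoc, ← Submodule.map_sup, hG.sup_eq_top, Submodule.map_top, hF.sup_eq_top]
  have hfg : (G.map A ⊔ F).FG := ((hN.fg_of_isCompl hG).map A).sup (hA.fg_of_isCompl hF)
  refine ⟨?_⟩
  have h := congrArg (Submodule.map (N.map A).mkQ) hsup
  rw [Submodule.map_sup, Submodule.mkQ_map_self, bot_sup_eq, Submodule.map_top,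
    Submodule.range_mkQ] at h
  exact h ▸ hfg.map (N.map A).mkQ

theorem LinearMap.range_pow_cofg {A : V →ₗ[K] V} (hA : (LinearMap.range A).CoFG) (n : ℕ) :
    (LinearMap.range (A ^ n)).CoFG := by
  induction n with
  | zero => rw [pow_zero, Module.End.one_eq_id, LinearMap.range_id]; exact Submodule.CoFG.top
  | succ n ih =>
    rw [pow_succ', Module.End.mul_eq_comp, LinearMap.range_comp]
    exact hA.map_of_range ih

/-- A surjective endomorphism preserving a subspace of finite codimension is injective modulo
that subspace. -/
theorem LinearMap.mem_of_apply_mem {A : V →ₗ[K] V} (hA : Function.Surjective A)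
    {I : Submodule K V} (hI : I.CoFG) (hAI : I ≤ I.comap A) {f : V} (hf : A f ∈ I) : f ∈ I := by
  have : FiniteDimensional K (V ⧸ I) := hI
  have hs : Function.Surjective (I.mapQ I A hAI) := by
    intro y
    obtain ⟨y, rfl⟩ := I.mkQ_surjective y
    obtain ⟨x, rfl⟩ := hA y
    exact ⟨I.mkQ x, rfl⟩
  -- Finite codimension enters here: on V / I, surjective implies injective.
  have hi := LinearMap.injective_iff_surjective.2 hs
  rw [← Submodule.Quotient.mk_eq_zero]
  apply hi
  rw [Submodule.mapQ_apply, map_zero]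
  exact (Submodule.Quotient.mk_eq_zero I).2 hf

/-- The same for an endomorphism which maps a subspace `R` onto itself. -/
theorem LinearMap.mem_of_apply_mem_of_map_eq {A : V →ₗ[K] V} {R : Submodule K V}
    (hR : R.map A = R) {I : Submodule K V} (hI : I.CoFG) (hAI : I ≤ I.comap A) {f : V}
    (hfR : f ∈ R) (hf : A f ∈ I) : f ∈ I := by
  have hmem : ∀ x ∈ R, A x ∈ R := fun x hx => hR ▸ Submodule.mem_map_of_mem hx
  have hs : Function.Surjective (A.restrict hmem) := by
    rintro ⟨y, hy⟩
    rw [← hR] at hy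
    obtain ⟨x, hx, rfl⟩ := hy
    exact ⟨⟨x, hx⟩, rfl⟩
  -- R / (I ∩ R) embeds in V / I, so the surjective case applies to A restricted to R.
  have hJ : (I.comap R.subtype).CoFG := by
    have : FiniteDimensional K (V ⧸ I) := hI
    have h := Submodule.CoFG.ker (I.mkQ ∘ₗ R.subtype)
    rwa [LinearMap.ker_comp, Submodule.ker_mkQ] at h
  exact LinearMap.mem_of_apply_mem hs hJ (fun x hx => hAI hx) (f := ⟨f, hfR⟩) hf

variable {T : V →ₗ[K] V} {I : ℕ → Submodule K V} {c : K} {e : ℕ → V}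

/-- Modulo I (n + 1), T is a scalar on I n; this works for every μ, so μ need not match the level n.
-/
theorem LinearMap.le_comap_sub_of_filtration (hanti : Antitone I)
    (hT : ∀ n, ∀ f ∈ I n, T f - c ^ n • f ∈ I (n + 1)) (μ : K) (n : ℕ) :
    I n ≤ (I n).comap (algebraMap K (Module.End K V) μ - T) := fun f hf => by
  have h := hanti n.le_succ (hT n f hf)
  have : (algebraMap K (Module.End K V) μ - T) f = (μ - c ^ n) • f - (T f - c ^ n • f) := by
    rw [LinearMap.sub_apply, Module.algebraMap_end_apply, sub_smul]; abel
  rw [Submodule.mem_comap, this]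
  exact Submodule.sub_mem _ (Submodule.smul_mem _ _ hf) h

/-- If `T` preserves a filtration of finite codimension and acts as `c ^ n` on its `n`-th graded
piece, then a subspace which `c ^ n - T` maps onto itself misses the `n`-th graded piece. -/
theorem LinearMap.mem_filtration_succ (hanti : Antitone I) (hI : ∀ n, (I n).CoFG)
    (hT : ∀ n, ∀ f ∈ I n, T f - c ^ n • f ∈ I (n + 1)) {n : ℕ} {R : Submodule K V}
    (hR : R.map (algebraMap K (Module.End K V) (c ^ n) - T) = R) {f : V} (hfR : f ∈ R)
    (hf : f ∈ I n) : f ∈ I (n + 1) := by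
  -- The invariant subspace used is I (n + 1), one level above the exponent in c ^ n: the operator c
  -- ^ n - T carries I n into it.
  refine LinearMap.mem_of_apply_mem_of_map_eq hR (hI _)
    (LinearMap.le_comap_sub_of_filtration hanti hT _ _) hfR ?_
  rw [LinearMap.sub_apply, Module.algebraMap_end_apply, ← neg_sub]
  exact Submodule.neg_mem _ (hT n f hf)

theorem LinearMap.not_surjective_of_filtration (hanti : Antitone I) (hI : ∀ n, (I n).CoFG)
    (hT : ∀ n, ∀ f ∈ I n, T f - c ^ n • f ∈ I (n + 1)) (he : ∀ n, e n ∈ I n)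
    (he' : ∀ n, e n ∉ I (n + 1)) (n : ℕ) :
    ¬ Function.Surjective (algebraMap K (Module.End K V) (c ^ n) - T) := fun h =>
  he' n <| LinearMap.mem_filtration_succ hanti hI hT (R := ⊤)
    (by rw [Submodule.map_top, LinearMap.range_eq_top.2 h]) trivial (he n)

/-- In the finite-dimensional V / R the images of the I n stabilise, so from some level on R
surjects onto every graded piece. At levels divisible by k, where c ^ n = 1, R must miss the graded
piece, which is nonzero because of e n. -/
theorem LinearMap.not_cofg_of_filtration (hanti : Antitone I) (hI : ∀ n, (I n).CoFG)
    (hT : ∀ n, ∀ f ∈ I n, T f - c ^ n • f ∈ I (n + 1)) (he : ∀ n, e n ∈ I n)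
    (he' : ∀ n, e n ∉ I (n + 1)) {k : ℕ} (hk : 0 < k) (hc : c ^ k = 1) {R : Submodule K V}
    (hR : R.map (algebraMap K (Module.End K V) 1 - T) = R) : ¬ R.CoFG := fun hfin => by
  have : FiniteDimensional K (V ⧸ R) := hfin
  obtain ⟨N, hN⟩ := IsArtinian.monotone_stabilizes
    (⟨fun n => OrderDual.toDual ((I n).map R.mkQ), fun _ _ h => Submodule.map_mono (hanti h)⟩ :
      ℕ →o (Submodule K (V ⧸ R))ᵒᵈ)
  -- The level k * N is both past the stabilisation index and a multiple of k.
  have hle : N ≤ k * N := Nat.le_mul_of_pos_left N hk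
  have heq : (I (k * N)).map R.mkQ = (I (k * N + 1)).map R.mkQ :=
    (hN _ hle).symm.trans (hN _ (hle.trans (Nat.le_succ _)))
  have hmem := Submodule.mem_map_of_mem (f := R.mkQ) (he (k * N))
  rw [heq] at hmem
  obtain ⟨i, hi, hie⟩ := hmem
  have hd : e (k * N) - i ∈ R := (Submodule.Quotient.eq R).1 hie.symm
  have hdI : e (k * N) - i ∈ I (k * N) := Submodule.sub_mem _ (he _) (hanti (Nat.le_succ _) hi)
  have hR' : R.map (algebraMap K (Module.End K V) (c ^ (k * N)) - T) = R := by
    rwa [pow_mul, hc, one_pow]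
  have := LinearMap.mem_filtration_succ hanti hI hT hR' hd hdI
  exact he' _ (by simpa using Submodule.add_mem _ this hi)

end LinearAlgebra

/-! ### Leading terms of the Leibniz and chain rules. -/

section ChainRule

variable {𝕜 : Type*} [NontriviallyNormedField 𝕜] {s : Set 𝕜} {x : 𝕜}

theorem iteratedDerivWithin_mul_of_vanishing (hs : UniqueDiffOn 𝕜 s) (hx : x ∈ s) {n : ℕ}
    {f g : 𝕜 → 𝕜} (hf : ContDiffOn 𝕜 ∞ f s) (hg : ContDiffOn 𝕜 ∞ g s)
    (h : ∀ j < n, iteratedDerivWithin j f s x = 0) :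
    iteratedDerivWithin n (fun y => f y * g y) s x = iteratedDerivWithin n f s x * g x := by
  have := iteratedDerivWithin_mul hx hs
    ((hf.of_le (by exact_mod_cast le_top) : ContDiffOn 𝕜 n f s) x hx)
    ((hg.of_le (by exact_mod_cast le_top) : ContDiffOn 𝕜 n g s) x hx)
  refine this.trans ?_
  rw [Finset.sum_range_succ, Finset.sum_eq_zero fun i hi => by
    rw [h i (Finset.mem_range.1 hi), mul_zero, zero_mul]]
  simp

/-- The lowest-order part of the higher chain rule at a fixed point: if the derivatives of `f` of
order less than `n` vanish at `x = g x`, then `(f ∘ g)⁽ⁿ⁾ x = g' x ^ n * f⁽ⁿ⁾ x`. -/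
theorem iteratedDerivWithin_comp_of_vanishing (hs : UniqueDiffOn 𝕜 s) (hx : x ∈ s)
    {g : 𝕜 → 𝕜} (hg : ContDiffOn 𝕜 ∞ g s) (hgs : Set.MapsTo g s s) (hgx : g x = x) (n : ℕ)
    {f : 𝕜 → 𝕜} (hf : ContDiffOn 𝕜 ∞ f s) (h : ∀ j < n, iteratedDerivWithin j f s x = 0) :
    iteratedDerivWithin n (f ∘ g) s x = derivWithin g s x ^ n * iteratedDerivWithin n f s x := by
  induction n using Nat.strong_induction_on generalizing f with
  | h n ih =>
    obtain _ | n := n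
    · simp [hgx]
    have hf' : ContDiffOn 𝕜 ∞ (derivWithin f s) s := hf.derivWithin hs (by simp)
    have hg' : ContDiffOn 𝕜 ∞ (derivWithin g s) s := hg.derivWithin hs (by simp)
    have hv : ∀ j < n, iteratedDerivWithin j (derivWithin f s) s x = 0 := fun j hj => by
      rw [← iteratedDerivWithin_succ']; exact h _ (by omega)
    -- Since (f ∘ g)' = (f' ∘ g) g', the induction passes to f', whose derivatives at x vanish one
    -- order fewer; hence the generalisation over f.
    have heq : Set.EqOn (derivWithin (f ∘ g) s)
        (fun y => (derivWithin f s ∘ g) y * derivWithin g s y) s := fun y hy =>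
      derivWithin_comp y (hf.differentiableOn (by simp) _ (hgs hy))
        (hg.differentiableOn (by simp) _ hy) hgs
    rw [iteratedDerivWithin_succ', iteratedDerivWithin_congr heq hx,
      iteratedDerivWithin_mul_of_vanishing hs hx (hf'.comp hg hgs) hg', ih n n.lt_succ_self hf' hv,
      iteratedDerivWithin_succ', pow_succ]
    · ring
    -- Side condition of the Leibniz step: the derivatives of f' ∘ g of order less than n vanish at
    -- x, again by induction.
    · intro j hj
      rw [ih j (hj.trans n.lt_succ_self) hf' fun i hi => hv i (hi.trans hj), hv j hj, mul_zero]

end ChainRule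

/-! ### The filtration of D(X, M) by order of vanishing at a point. -/

section PointDerivations

open PerfectCompact

variable {X : PerfectCompact} {M : WeightSequence}

theorem PerfectCompact.iterDeriv_eq_iteratedDeriv {h : ℂ → ℂ} (hh : ContDiff ℂ ∞ h) (n : ℕ)
    (x : X.carrier) : X.iterDeriv n (fun y => h y) x = iteratedDeriv n h x := by
  rw [iterDeriv, iteratedDerivWithin_congr (g := h) (fun z hz => zeroExt_of_mem _ hz) x.2]
  exact iteratedDerivWithin_eq_iteratedDeriv uniqueDiffOn
    ((hh.of_le (by exact_mod_cast le_top)).contDiffAt) x.2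

theorem PerfectCompact.isSmooth_of_contDiff {h : ℂ → ℂ} (hh : ContDiff ℂ ∞ h) :
    X.IsSmooth fun y => h y :=
  isSmooth_iff_contDiffOn.2 (hh.contDiffOn.congr fun _ hz => zeroExt_of_mem _ hz)

theorem iteratedDeriv_sub_pow (a : ℂ) (m n : ℕ) (z : ℂ) :
    iteratedDeriv n (fun y => (y - a) ^ m) z = m.descFactorial n * (z - a) ^ (m - n) := by
  have := congrFun (iteratedDeriv_comp_sub_const n (fun y : ℂ => y ^ m) a) z
  rw [this, iteratedDeriv_pow]

namespace DalesDavie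

variable (X M) in
/-- The function `(z - a) ^ m` as an element of `D(X, M)`. -/
def subPow (a : ℂ) (m : ℕ) : DalesDavie X M :=
  ⟨fun y => ((y : ℂ) - a) ^ m, isSmooth_of_contDiff (h := fun z => (z - a) ^ m) (by fun_prop), by
    refine summable_of_ne_finset_zero (s := Finset.range (m + 1)) fun n hn => ?_
    have : X.iterDeriv n (fun y => ((y : ℂ) - a) ^ m) = 0 := by
      funext x
      rw [iterDeriv_eq_iteratedDeriv (h := fun z => (z - a) ^ m) (by fun_prop),
        iteratedDeriv_sub_pow, Nat.descFactorial_of_lt (by simpa using hn)]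
      simp
    rw [daviesTerm, this]
    simp [supNorm]⟩

theorem subPow_apply (a : ℂ) (m : ℕ) (x : X.carrier) : subPow X M a m x = ((x : ℂ) - a) ^ m := rfl

theorem iterDeriv_subPow (a : ℂ) (m n : ℕ) (x : X.carrier) :
    X.iterDeriv n (subPow X M a m) x = m.descFactorial n * ((x : ℂ) - a) ^ (m - n) :=
  (iterDeriv_eq_iteratedDeriv (h := fun z => (z - a) ^ m) (by fun_prop) n x).trans
    (iteratedDeriv_sub_pow a m n x)

variable (M) in
/-- The functional `f ↦ f⁽ⁿ⁾ x`. -/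
def pointDeriv (x : X.carrier) (n : ℕ) : DalesDavie X M →ₗ[ℂ] ℂ where
  toFun f := X.iterDeriv n f x
  map_add' f g := congrFun (iterDeriv_add f.isSmooth g.isSmooth n) x
  map_smul' c f := congrFun (iterDeriv_smul c (f : X.carrier → ℂ) n) x

variable (M) in
/-- The functions whose derivatives of order less than `n` vanish at `x`. -/
def vanishing (x : X.carrier) (n : ℕ) : Submodule ℂ (DalesDavie X M) :=
  LinearMap.ker (LinearMap.pi fun j : Fin n => pointDeriv M x j)

theorem mem_vanishing {x : X.carrier} {n : ℕ} {f : DalesDavie X M} :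
    f ∈ vanishing M x n ↔ ∀ j < n, X.iterDeriv j f x = 0 := by
  rw [vanishing, LinearMap.mem_ker, funext_iff]
  exact ⟨fun h j hj => h ⟨j, hj⟩, fun h j => h j j.2⟩

theorem vanishing_cofg (x : X.carrier) (n : ℕ) : (vanishing M x n).CoFG := Submodule.CoFG.ker _

theorem vanishing_antitone (x : X.carrier) : Antitone (vanishing M x) := fun _ _ h _ hf =>
  mem_vanishing.2 fun j hj => mem_vanishing.1 hf j (hj.trans_le h)

theorem subPow_mem_vanishing (x : X.carrier) (n : ℕ) : subPow X M x n ∈ vanishing M x n :=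
  mem_vanishing.2 fun j hj => by
    rw [iterDeriv_subPow, sub_self, zero_pow (by omega), mul_zero]

theorem subPow_notMem_vanishing (x : X.carrier) (n : ℕ) :
    subPow X M x n ∉ vanishing M x (n + 1) := fun h => by
  have := mem_vanishing.1 h n n.lt_succ_self
  rw [iterDeriv_subPow, Nat.descFactorial_self, Nat.sub_self, pow_zero, mul_one] at this
  exact n.factorial_ne_zero (by exact_mod_cast this)

variable {T : DalesDavie X M →ₗ[ℂ] DalesDavie X M} {φ : X.carrier → X.carrier}

/-- φ is T applied to the coordinate function, here (z - 0) ^ 1, and hence belongs to D(X, M). -/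
theorem isSmooth_of_comp (hφ : ∀ f x, T f x = f (φ x)) : X.IsSmooth fun x => (φ x : ℂ) := by
  have h := (T (subPow X M 0 1)).isSmooth
  have heq : (T (subPow X M 0 1) : X.carrier → ℂ) = fun x => (φ x : ℂ) := by
    funext x
    rw [hφ, subPow_apply, sub_zero, pow_one]
  rwa [heq] at h

/-- The higher chain rule at the fixed point: below order n both terms have zero derivatives, and at
order n they cancel. -/
theorem comp_sub_smul_mem_vanishing (hφ : ∀ f x, T f x = f (φ x)) {x₀ : X.carrier}
    (hx₀ : φ x₀ = x₀) (n : ℕ) (f : DalesDavie X M) (hf : f ∈ vanishing M x₀ n) :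
    T f - X.deriv (fun x => (φ x : ℂ)) x₀ ^ n • f ∈ vanishing M x₀ (n + 1) := by
  set g : ℂ → ℂ := X.zeroExt fun x => (φ x : ℂ)
  have hgφ : ∀ x : X.carrier, g x = φ x := zeroExt_apply _
  have key : ∀ j ≤ n, X.iterDeriv j (T f) x₀ =
      X.deriv (fun x => (φ x : ℂ)) x₀ ^ j * X.iterDeriv j f x₀ := fun j hj => by
    have heq : Set.EqOn (X.zeroExt (T f)) (X.zeroExt f ∘ g) X.carrier := fun z hz => by
      rw [zeroExt_of_mem _ hz, hφ, Function.comp_apply, hgφ ⟨z, hz⟩, zeroExt_apply]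
    rw [iterDeriv, iteratedDerivWithin_congr heq x₀.2]
    exact iteratedDerivWithin_comp_of_vanishing uniqueDiffOn x₀.2
      (isSmooth_iff_contDiffOn.1 (isSmooth_of_comp hφ))
      (fun z hz => (hgφ ⟨z, hz⟩).symm.subst (motive := (· ∈ X.carrier)) (φ _).2)
      ((hgφ x₀).trans (by rw [hx₀])) j
      (isSmooth_iff_contDiffOn.1 f.isSmooth) fun i hi => mem_vanishing.1 hf i (hi.trans_le hj)
  refine mem_vanishing.2 fun j hj => ?_
  have hlin : ∀ c : ℂ, pointDeriv M x₀ j (T f - c • f) =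
      X.iterDeriv j (T f) x₀ - c * X.iterDeriv j f x₀ := fun c => by
    rw [map_sub, map_smul]; rfl
  refine (hlin _).trans ?_
  rw [key j (Nat.lt_succ_iff.1 hj)]
  rcases (Nat.lt_succ_iff.1 hj).lt_or_eq with h | rfl
  · rw [mem_vanishing.1 hf j h, mul_zero, mul_zero, sub_zero]
  · rw [sub_self]

end DalesDavie

end PointDerivations

/-! ### Spectrum and image chain of a Riesz operator. -/

section Riesz

theorem mem_spectrum_of_not_surjective {B : Type*} [NormedAddCommGroup B] [NormedSpace ℂ B]
    {T : B →L[ℂ] B} {μ : ℂ}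
    (h : ¬ Function.Surjective (algebraMap ℂ (Module.End ℂ B) μ - T.toLinearMap)) :
    μ ∈ spectrum ℂ T := fun hu => h fun y => by
  obtain ⟨u, hu⟩ := hu
  refine ⟨(↑u⁻¹ : B →L[ℂ] B) y, ?_⟩
  have := DFunLike.congr_fun u.mul_inv y
  rw [hu] at this
  exact this

/-- The spectrum of a Riesz operator has no accumulation point away from `0`. -/
theorem IsRieszOperator.finite_spectrum_inter {B : Type*} [NormedAddCommGroup B]
    [NormedSpace ℂ B] {T : B →L[ℂ] B} (hT : IsRieszOperator T) :
    {μ ∈ spectrum ℂ T | 1 ≤ ‖μ‖}.Finite := by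
  have hsub : {μ ∈ spectrum ℂ T | 1 ≤ ‖μ‖} ⊆ {μ ∈ spectrum ℂ T | μ ≠ 0} := fun μ h =>
    ⟨h.1, fun h0 => by have := h.2; rw [h0, norm_zero] at this; linarith⟩
  by_cases hinf : {μ ∈ spectrum ℂ T | μ ≠ 0}.Infinite
  · obtain ⟨u, hu, hlim⟩ := hT.spectrum_tendsto_zero hinf
    have hev : ∀ᶠ n in atTop, ‖u n‖ < 1 := by
      have := hlim.norm
      rw [norm_zero] at this
      exact this.eventually_lt_const one_pos
    obtain ⟨N, hN⟩ := eventually_atTop.1 hev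
    -- Only the first N terms of a sequence tending to 0 can have modulus at least 1.
    refine ((Set.finite_lt_nat N).image u).subset fun μ hμ => ?_
    obtain ⟨n, rfl⟩ : μ ∈ Set.range u := hu ▸ hsub hμ
    exact ⟨n, not_le.1 fun h => (hN n h).not_ge hμ.2, rfl⟩
  · exact (Set.not_infinite.1 hinf).subset hsub

/-- Take R to be the range of (μ - T) ^ p, with p the length of the image chain: one more
application leaves it unchanged, and powers of an operator with range of finite codimension again
have such a range. -/
theorem IsRieszOperator.exists_range_cofg_map_eq {B : Type*} [NormedAddCommGroup B]
    [NormedSpace ℂ B] {T : B →L[ℂ] B} (hT : IsRieszOperator T) {μ : ℂ} (hμ : μ ≠ 0) :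
    ∃ R : Submodule ℂ B, R.CoFG ∧
      R.map (algebraMap ℂ (Module.End ℂ B) μ - T.toLinearMap) = R := by
  obtain ⟨p, -, hp, -⟩ := hT.chains μ hμ
  set A : Module.End ℂ B := algebraMap ℂ (Module.End ℂ B) μ - T.toLinearMap
  have hpow : ∀ n : ℕ, ((algebraMap ℂ (B →L[ℂ] B) μ - T) ^ n).toLinearMap = A ^ n := by
    intro n
    induction n with
    | zero => rfl
    | succ n ih => rw [pow_succ, pow_succ, ← ih]; rfl
  have hcoker : (LinearMap.range A).CoFG := hT.finite_coker μ hμ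
  refine ⟨LinearMap.range (A ^ p), LinearMap.range_pow_cofg hcoker p, ?_⟩
  rw [Set.mem_ofPred_eq, hpow, hpow] at hp
  rw [← LinearMap.range_comp, ← Module.End.mul_eq_comp, ← pow_succ']
  exact hp.symm

end Riesz

theorem exists_pow_eq_one_of_finite_range {c : ℂ} (hc : c ≠ 0)
    (h : (Set.range fun n : ℕ => c ^ n).Finite) : ∃ k, 0 < k ∧ c ^ k = 1 := by
  obtain ⟨m, n, hmn, heq⟩ : ∃ m n : ℕ, m < n ∧ c ^ m = c ^ n := by
    have hni : ¬ Function.Injective fun n : ℕ => c ^ n := fun hi =>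
      Set.infinite_range_of_injective hi h
    simp only [Function.Injective, not_forall] at hni
    obtain ⟨m, n, heq, hne⟩ := hni
    rcases Ne.lt_or_gt hne with hlt | hlt
    · exact ⟨m, n, hlt, heq⟩
    · exact ⟨n, m, hlt, heq.symm⟩
  refine ⟨n - m, Nat.sub_pos_of_lt hmn, mul_left_cancel₀ (pow_ne_zero m hc) ?_⟩
  rw [← pow_add, Nat.add_sub_cancel' hmn.le, mul_one, heq]

end

theorem lemma2p2 (X : PerfectCompact) (hX : IsConnected X.carrier) (M : WeightSequence)
    (hM : M.IsNonanalytic) (hD : CompleteSpace (DalesDavie X M))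
    (hXM : DalesDavie.MaximalIdealSpaceEq X M)
    (T : DalesDavie X M →A[ℂ] DalesDavie X M)
    (hT : IsRieszOperator T.toContinuousLinearMap)
    (φ : X.carrier → X.carrier)
    (hφ : ∀ (f : DalesDavie X M) (x : X.carrier), T f x = f (φ x))
    (x₀ : X.carrier) (hx₀ : φ x₀ = x₀) :
    X.DifferentiableAt (fun x => (φ x : ℂ)) x₀ ∧ ‖X.deriv (fun x => (φ x : ℂ)) x₀‖ < 1 := by
  have hφ' : ∀ f x, T.toContinuousLinearMap.toLinearMap f x = f (φ x) := hφ
  constructor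
  -- Order 0 of smoothness is differentiability of φ itself.
  · have := DalesDavie.isSmooth_of_comp hφ' 0 x₀
    rwa [PerfectCompact.iterDeriv_zero] at this
  by_contra! hc
  set c := X.deriv (fun x => (φ x : ℂ)) x₀
  have hc0 : c ≠ 0 := norm_pos_iff.1 (one_pos.trans_le hc)
  have hgr := DalesDavie.comp_sub_smul_mem_vanishing hφ' hx₀
  have hfin : (Set.range fun n : ℕ => c ^ n).Finite := by
    refine hT.finite_spectrum_inter.subset ?_
    rintro _ ⟨n, rfl⟩
    refine ⟨mem_spectrum_of_not_surjective ?_, by rw [norm_pow]; exact one_le_pow₀ hc⟩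
    exact LinearMap.not_surjective_of_filtration (DalesDavie.vanishing_antitone x₀)
      (DalesDavie.vanishing_cofg x₀) hgr (DalesDavie.subPow_mem_vanishing x₀)
      (DalesDavie.subPow_notMem_vanishing x₀) n
  obtain ⟨k, hk, hck⟩ := exists_pow_eq_one_of_finite_range hc0 hfin
  -- The relevant spectral value is μ = 1, since it equals c ^ n for every multiple n of k.
  obtain ⟨R, hR, hRT⟩ := hT.exists_range_cofg_map_eq one_ne_zero
  exact LinearMap.not_cofg_of_filtration (DalesDavie.vanishing_antitone x₀)
    (DalesDavie.vanishing_cofg x₀) hgr (DalesDavie.subPow_mem_vanishing x₀)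
    (DalesDavie.subPow_notMem_vanishing x₀) hk hck hRT hR
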